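/- For $f\in L^1(\mathbb R)$ let $\widehat f(t)=\int_{\mathbb R} f(x)\,e^{-2\pi i x t}\,dx$. A (complex) Radon measure on $\mathbb R$ is a linear functional $\mu$ on the space $C_c(\mathbb R)$ of continuous complex-valued functions with compact support such that for every compact $K\subset\mathbb R$ there is a constant $C_K$ with $|\mu(\varphi)|\le C_K\|\varphi\|_\infty$ whenever $\operatorname{supp}\varphi\subseteq K$. It is signed if $\mu(\varphi)\in\mathbb R$ for all real-valued $\varphi$. Its total variation $|\mu|$ is the smallest positive locally finite Borel measure $\nu$ on $\mathbb{R}$ with $|\mu(\varphi)|\le\int|\varphi|\,d\nu$ for all $\varphi\in C_c(\mathbb R)$. A Radon measure $\mu$ is tempered if there is a tempered distribution $T$ with $\mu(\varphi)=T(\varphi)$ for all $\varphi\in C_c^\infty(\mathbb R)$, and slowly increasing if $\int_{\mathbb R}\frac{d|\mu|(x)}{1+|P(x)|}<\infty$ for some polynomial $P\in\mathbb C[x]$. A sequence $\mu_n$ converges vaguely to $\mu$ if $\mu_n(\varphi)\to\mu(\varphi)$ for every $\varphi\in C_c(\mathbb R)$. **Proposition.** (a) There is a sequence of real-valued functions $g_n\in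 C_c(\mathbb R)$, $n=1,2,3,\dots$, such that for all $n \geq 1$ $$\operatorname{supp}(g_n)\subseteq\Bigl[-\tfrac1{n+1},\tfrac1{n+1}\Bigr],\qquad \|g_n\|_1\ge (n^2+1)^n,\qquad \|\widehat{g_n}\|_\infty\le 2^{-n}.\tag{$*$}$$ (b) Let $g_n\in C_c(\mathbb R)$, $n\ge1$, be any (complex-valued) functions satisfying $(*)$ for all $n \geq 1$, and set $$\mu_n(\varphi)=\sum_{j=1}^n\int_{\mathbb R}\varphi(x)\,g_j(x+j)\,dx\qquad(\varphi\in C_c(\mathbb R)).$$ Then the Radon measures $\mu_n$ converge vaguely to a Radon measure $\mu$ that is tempered but not slowly increasing. If all $g_n$ are real-valued, then $\mu$ is a signed Radon measure. -/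

import Mathlib

open MeasureTheory Filter Topology FourierTransform
open scoped CompactlySupported SchwartzMap ContDiff Polynomial

/-- A (complex) Radon measure on `ℝ`, as a linear functional on `C_c(ℝ, ℂ)` that is continuous
for the inductive limit topology: on functions supported in a fixed compact set `K` it is
bounded by a constant (depending on `K`) times the supremum norm. -/
structure RadonMeasure where
  /-- The value `μ(φ)`. -/
  toLinearMap : C_c(ℝ, ℂ) →ₗ[ℂ] ℂ
  bounded' : ∀ K : Set ℝ, IsCompact K → ∃ C : ℝ, ∀ (φ : C_c(ℝ, ℂ)) (M : ℝ),
    tsupport φ ⊆ K → (∀ x, ‖φ x‖ ≤ M) → ‖toLinearMap φ‖ ≤ C * M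

namespace RadonMeasure

noncomputable instance : CoeFun RadonMeasure (fun _ => C_c(ℝ, ℂ) → ℂ) := ⟨fun μ φ => μ.toLinearMap φ⟩

/-- A Radon measure is signed if it takes real values on real-valued functions. -/
def IsSigned (μ : RadonMeasure) : Prop :=
  ∀ φ : C_c(ℝ, ℂ), (∀ x, (φ x).im = 0) → (μ φ).im = 0

/-- The total variation measure `|μ|`: the smallest positive, locally finite Borel measure `ν`
such that `|μ(φ)| ≤ ν(|φ|)` for all `φ ∈ C_c(ℝ, ℂ)`. -/
noncomputable def variation (μ : RadonMeasure) : Measure ℝ :=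
  sInf {ν : Measure ℝ | IsLocallyFiniteMeasure ν ∧
    ∀ φ : C_c(ℝ, ℂ), ‖μ φ‖ₑ ≤ ∫⁻ x, ‖φ x‖ₑ ∂ν}

/-- `μ` is tempered if it agrees on `C_c^∞` with some tempered distribution. -/
def IsTempered (μ : RadonMeasure) : Prop :=
  ∃ T : 𝓢'(ℝ, ℂ), ∀ (φ : C_c(ℝ, ℂ)) (hφ : ContDiff ℝ ∞ φ),
    μ φ = T (φ.hasCompactSupport.toSchwartzMap hφ)

/-- `μ` is slowly increasing if `∫ d|μ|(x) / (1 + |P(x)|) < ∞` for some complex polynomial `P`. -/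
def IsSlowlyIncreasing (μ : RadonMeasure) : Prop :=
  ∃ P : ℂ[X], ∫⁻ x : ℝ, ENNReal.ofReal (1 / (1 + ‖P.eval (x : ℂ)‖)) ∂μ.variation < ⊤

/-- Vague convergence: convergence tested against every function in `C_c(ℝ, ℂ)`. -/
def VagueTendsto (μs : ℕ → RadonMeasure) (μ : RadonMeasure) : Prop :=
  ∀ φ : C_c(ℝ, ℂ), Tendsto (fun n => μs n φ) atTop (𝓝 (μ φ))

end RadonMeasure

/-- The three properties required of the functions `g_n`, `n = 1, 2, 3, …`
(the value at index `0` is irrelevant). -/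
def IsAdmissibleSequence (g : ℕ → C_c(ℝ, ℂ)) : Prop :=
  ∀ n : ℕ, 1 ≤ n →
    tsupport (g n) ⊆ Set.Icc (-(1 / ((n : ℝ) + 1))) (1 / ((n : ℝ) + 1)) ∧
    ((n : ℝ) ^ 2 + 1) ^ n ≤ ∫ x, ‖g n x‖ ∧
    ∀ t : ℝ, ‖𝓕 (fun x : ℝ => g n x) t‖ ≤ (2 : ℝ)⁻¹ ^ n

theorem continuous_mul_translate (φ g : C_c(ℝ, ℂ)) (a : ℝ) :
    Continuous (fun x => φ x * g (x + a)) :=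
  (map_continuous φ).mul ((map_continuous g).comp (continuous_id.add continuous_const))

theorem integrable_mul_translate (φ g : C_c(ℝ, ℂ)) (a : ℝ) :
    Integrable (fun x => φ x * g (x + a)) :=
  (continuous_mul_translate φ g a).integrable_of_hasCompactSupport φ.hasCompactSupport.mul_right

theorem integrable_norm_translate (g : C_c(ℝ, ℂ)) (a : ℝ) :
    Integrable (fun x => ‖g (x + a)‖) :=
  (((map_continuous g).integrable_of_hasCompactSupport g.hasCompactSupport).comp_add_right a).norm

/-- The Radon measure `μ_n(φ) = ∑_{j=1}^n ∫ φ(x) g_j(x+j) dx`. -/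
noncomputable def partialMeasure (g : ℕ → C_c(ℝ, ℂ)) (n : ℕ) : RadonMeasure where
  toLinearMap :=
    { toFun := fun φ => ∑ j ∈ Finset.Icc 1 n, ∫ x : ℝ, φ x * g j (x + (j : ℝ))
      map_add' := by
        intro φ ψ
        rw [← Finset.sum_add_distrib]
        refine Finset.sum_congr rfl fun j _ => ?_
        rw [← integral_add (integrable_mul_translate φ (g j) j)
          (integrable_mul_translate ψ (g j) j)]
        simp [add_mul]
      map_smul' := by
        intro c φ
        simp only [CompactlySupportedContinuousMap.coe_smul, Pi.smul_apply, smul_eq_mul,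
          RingHom.id_apply, mul_assoc, integral_const_mul, Finset.mul_sum] }
  bounded' := by
    intro K _
    refine ⟨∑ j ∈ Finset.Icc 1 n, ∫ x : ℝ, ‖g j (x + (j : ℝ))‖, fun φ M _ hM => ?_⟩
    have h1 : ∀ j ∈ Finset.Icc 1 n, ‖∫ x : ℝ, φ x * g j (x + (j : ℝ))‖ ≤
        (∫ x : ℝ, ‖g j (x + (j : ℝ))‖) * M := by
      intro j _
      refine (norm_integral_le_integral_norm (fun x : ℝ => φ x * g j (x + (j : ℝ)))).trans ?_
      rw [← integral_mul_const]
      refine integral_mono (integrable_mul_translate φ (g j) j).norm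
        ((integrable_norm_translate (g j) j).mul_const M) fun x => ?_
      simp only [norm_mul]
      rw [mul_comm]
      exact mul_le_mul_of_nonneg_left (hM x) (norm_nonneg _)
    rw [Finset.sum_mul]
    exact norm_sum_le_of_le (Finset.Icc 1 n) h1

/-!
For part (a) the point is that a small supremum of the Fourier transform does not bound the `L¹`
norm. The Rudin–Shapiro recursion shows this with real functions: replacing a pair `(P, Q)` by
`(P(· + a) + Q(· - a), P(· + a) - Q(· - a))`, where `a` separates the supports, doubles both `L¹`
norms, while by the parallelogram law `|P̂|² + |Q̂|²` is only doubled, so that after `m` steps the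
transform is of size `2 ^ (m / 2)` against a norm `2 ^ m` (`exists_rudinShapiro_pair`).

For part (b), the translates `g_j(· + j)` have disjoint supports marching off to `-∞`, so that their
sum `h` is a continuous function, and `φ ↦ ∫ φ h` is the vague limit
(`IsAdmissibleSequence.vagueTendsto`). Its variation dominates `|h| dx`, as one sees by testing
against `ψ * conj h / (|h| + ε)` (`RadonMeasure.withDensity_le_variation_ofDensity`); since `|h|` has
mass at least `(n² + 1)ⁿ` near `-n`, no polynomial weight makes it finite
(`RadonMeasure.not_isSlowlyIncreasing_ofDensity`). On the other hand translation does not change the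
modulus of a Fourier transform, so `G = ∑ⱼ (g_j(· + j))^` converges uniformly to a bounded continuous
function, and the limit measure is the inverse Fourier transform of the tempered distribution `G`
(`IsAdmissibleSequence.exists_tendsto_temperedDistribution`).
-/

/-! ### Flat functions with small support -/

theorem fourier_comp_add_right (f : ℝ → ℂ) (a t : ℝ) :
    𝓕 (fun x => f (x + a)) t = Real.fourierChar (innerₗ ℝ a t) • 𝓕 f t :=
  congrFun (VectorFourier.fourierIntegral_comp_add_right Real.fourierChar volume (innerₗ ℝ) f a) t

theorem fourier_add_of_integrable {f g : ℝ → ℂ} (hf : Integrable f) (hg : Integrable g) (t : ℝ) :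
    𝓕 (fun x => f x + g x) t = 𝓕 f t + 𝓕 g t := by
  simp only [Real.fourier_eq, smul_add]
  exact integral_add ((Real.fourierIntegral_convergent_iff t).2 hf)
    ((Real.fourierIntegral_convergent_iff t).2 hg)

theorem fourier_sub_of_integrable {f g : ℝ → ℂ} (hf : Integrable f) (hg : Integrable g) (t : ℝ) :
    𝓕 (fun x => f x - g x) t = 𝓕 f t - 𝓕 g t := by
  simp only [Real.fourier_eq, smul_sub]
  exact integral_sub ((Real.fourierIntegral_convergent_iff t).2 hf)
    ((Real.fourierIntegral_convergent_iff t).2 hg)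

theorem norm_fourier_le_integral_norm (f : ℝ → ℂ) (t : ℝ) : ‖𝓕 f t‖ ≤ ∫ x, ‖f x‖ :=
  VectorFourier.norm_fourierIntegral_le_integral_norm _ _ _ _ _

theorem hasCompactSupport_of_support_subset_Icc {f : ℝ → ℝ} {a b : ℝ}
    (hf : f.support ⊆ Set.Icc a b) : HasCompactSupport f :=
  HasCompactSupport.of_support_subset_isCompact isCompact_Icc hf

theorem integral_abs_add_of_disjoint_support {u v w : ℝ → ℝ} (hu : Integrable u)
    (hv : Integrable v) (huv : ∀ x, u x = 0 ∨ v x = 0)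
    (hw : ∀ x, w x = u x + v x ∨ w x = u x - v x) :
    ∫ x, |w x| = (∫ x, |u x|) + ∫ x, |v x| := by
  rw [← integral_add hu.abs hv.abs]
  congr 1
  ext x
  rcases huv x with h | h <;> rcases hw x with h' | h' <;> simp [h', h]

/-- The Rudin–Shapiro construction at the level of functions. From a pair `(P, Q)` one passes to
`(P(· + a) + Q(· - a), P(· + a) - Q(· - a))`: the supports are disjoint, so the `L¹` norms add up,
whereas by the parallelogram law `|P̂|² + |Q̂|²` only doubles. -/
theorem exists_rudinShapiro_pair (m : ℕ) : ∀ δ : ℝ, 0 < δ → ∃ P Q : ℝ → ℝ,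
    Continuous P ∧ Continuous Q ∧
    P.support ⊆ Set.Icc (-δ) δ ∧ Q.support ⊆ Set.Icc (-δ) δ ∧
    ∫ x, |P x| = 2 ^ m ∧ ∫ x, |Q x| = 2 ^ m ∧
    ∀ t : ℝ, ‖𝓕 (fun x => (P x : ℂ)) t‖ ^ 2 + ‖𝓕 (fun x => (Q x : ℂ)) t‖ ^ 2 ≤ 2 ^ (m + 1) := by
  induction m with
  | zero =>
    intro δ hδ
    let b : ContDiffBump (0 : ℝ) := ⟨δ / 2, δ, by positivity, by linarith⟩
    have hs : (b.normed volume).support ⊆ Set.Icc (-δ) δ := by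
      rw [b.support_normed_eq, Real.ball_eq_Ioo]
      simpa [b] using Set.Ioo_subset_Icc_self
    have hi : ∫ x, |b.normed volume x| = 1 := by
      simp_rw [abs_of_nonneg (b.nonneg_normed _)]
      exact b.integral_normed
    have hF (t : ℝ) : ‖𝓕 (fun x => (b.normed volume x : ℂ)) t‖ ≤ 1 := by
      simpa [hi] using norm_fourier_le_integral_norm (fun x => (b.normed volume x : ℂ)) t
    refine ⟨b.normed volume, b.normed volume, b.continuous_normed, b.continuous_normed, hs, hs,
      by simpa using hi, by simpa using hi, fun t => ?_⟩
    have := pow_le_one₀ (n := 2) (norm_nonneg _) (hF t)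
    norm_num
    linarith
  | succ m ih =>
    intro δ hδ
    obtain ⟨P, Q, hPc, hQc, hPs, hQs, hP1, hQ1, hF⟩ := ih (δ / 3) (by positivity)
    have hPi : Integrable P :=
      hPc.integrable_of_hasCompactSupport (hasCompactSupport_of_support_subset_Icc hPs)
    have hQi : Integrable Q :=
      hQc.integrable_of_hasCompactSupport (hasCompactSupport_of_support_subset_Icc hQs)
    have hPi' := hPi.comp_add_right (δ / 2)
    have hQi' := hQi.comp_add_right (-(δ / 2))
    have hPz (x : ℝ) (hx : P (x + δ / 2) ≠ 0) : x ∈ Set.Icc (-δ) 0 ∧ x < 0 := by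
      have := hPs hx
      simp only [Set.mem_Icc] at this ⊢
      refine ⟨⟨?_, ?_⟩, ?_⟩ <;> linarith
    have hQz (x : ℝ) (hx : Q (x + -(δ / 2)) ≠ 0) : x ∈ Set.Icc 0 δ ∧ 0 < x := by
      have := hQs hx
      simp only [Set.mem_Icc] at this ⊢
      refine ⟨⟨?_, ?_⟩, ?_⟩ <;> linarith
    have hdisj (x : ℝ) : P (x + δ / 2) = 0 ∨ Q (x + -(δ / 2)) = 0 := by
      by_contra! h
      exact lt_asymm (hPz x h.1).2 (hQz x h.2).2
    have hsupp (w : ℝ → ℝ)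
        (hw : ∀ x, P (x + δ / 2) = 0 → Q (x + -(δ / 2)) = 0 → w x = 0) :
        w.support ⊆ Set.Icc (-δ) δ := by
      intro x hx
      by_cases h : P (x + δ / 2) = 0
      · have h' : Q (x + -(δ / 2)) ≠ 0 := fun h' => hx (hw x h h')
        exact Set.Icc_subset_Icc (by linarith) le_rfl (hQz x h').1
      · exact Set.Icc_subset_Icc le_rfl hδ.le (hPz x h).1
    have hL1 : (∫ x, |P (x + δ / 2)|) + ∫ x, |Q (x + -(δ / 2))| = 2 ^ (m + 1) := by
      rw [integral_add_right_eq_self (fun x => |P x|), integral_add_right_eq_self (fun x => |Q x|),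
        hP1, hQ1, pow_succ, mul_two]
    refine ⟨fun x => P (x + δ / 2) + Q (x + -(δ / 2)), fun x => P (x + δ / 2) - Q (x + -(δ / 2)),
      by fun_prop, by fun_prop, hsupp _ fun x h h' => by simp [h, h'],
      hsupp _ fun x h h' => by simp [h, h'], ?_, ?_, fun t => ?_⟩
    · rw [← hL1]
      exact integral_abs_add_of_disjoint_support hPi' hQi' hdisj fun x => .inl rfl
    · rw [← hL1]
      exact integral_abs_add_of_disjoint_support hPi' hQi' hdisj fun x => .inr rfl
    · simp only [Complex.ofReal_add (P _), Complex.ofReal_sub]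
      have hPi'' : Integrable fun x => (P (x + δ / 2) : ℂ) := hPi'.ofReal
      have hQi'' : Integrable fun x => (Q (x + -(δ / 2)) : ℂ) := hQi'.ofReal
      rw [fourier_add_of_integrable hPi'' hQi'', fourier_sub_of_integrable hPi'' hQi'',
        fourier_comp_add_right (fun x => (P x : ℂ)), fourier_comp_add_right (fun x => (Q x : ℂ))]
      have h := parallelogram_law_with_norm ℝ
        (Real.fourierChar (innerₗ ℝ (δ / 2) t) • 𝓕 (fun x => (P x : ℂ)) t)
        (Real.fourierChar (innerₗ ℝ (-(δ / 2)) t) • 𝓕 (fun x => (Q x : ℂ)) t)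
      simp only [Circle.norm_smul] at h
      have := hF t
      rw [pow_succ (2 : ℝ) (m + 1)]
      linarith

/-- A continuous real function with arbitrarily small support, arbitrarily large `L¹` norm and
arbitrarily small Fourier transform. -/
theorem exists_small_fourier_large_integral {δ A ε : ℝ} (hδ : 0 < δ) (hA : 0 < A) (hε : 0 < ε) :
    ∃ g : C_c(ℝ, ℂ), tsupport g ⊆ Set.Icc (-δ) δ ∧ A ≤ ∫ x, ‖g x‖ ∧
      (∀ t : ℝ, ‖𝓕 (fun x : ℝ => g x) t‖ ≤ ε) ∧ ∀ x, (g x).im = 0 := by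
  -- The normalisation `A / 2 ^ m` leaves a transform of square at most `2 * A ^ 2 / 2 ^ m`.
  obtain ⟨m, hm⟩ := pow_unbounded_of_one_lt (2 * A ^ 2 / ε ^ 2) (one_lt_two (α := ℝ))
  obtain ⟨P, Q, hPc, -, hPs, -, hP1, -, hF⟩ := exists_rudinShapiro_pair m δ hδ
  set c : ℝ := A / 2 ^ m with hc
  have hc0 : 0 < c := by positivity
  have hts : tsupport (fun x => ((c * P x : ℝ) : ℂ)) ⊆ Set.Icc (-δ) δ := by
    refine closure_minimal (fun x hx => hPs fun h => hx ?_) isClosed_Icc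
    simp [h]
  refine ⟨⟨⟨fun x => ((c * P x : ℝ) : ℂ), by fun_prop⟩,
    isCompact_Icc.of_isClosed_subset (isClosed_tsupport _) hts⟩, hts, ?_, fun t => ?_,
    fun x => Complex.ofReal_im _⟩
  · change A ≤ ∫ x, ‖((c * P x : ℝ) : ℂ)‖
    simp only [Complex.norm_real, Real.norm_eq_abs, abs_mul, abs_of_pos hc0]
    rw [integral_const_mul, hP1, hc, div_mul_cancel₀ _ (by positivity)]
  · have h1 : 𝓕 (fun x => ((c * P x : ℝ) : ℂ)) t = c * 𝓕 (fun x => (P x : ℂ)) t := by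
      simp only [Real.fourier_eq, ← integral_const_mul]
      congr 1
      ext x
      simp only [Circle.smul_def, smul_eq_mul]
      push_cast
      ring
    change ‖𝓕 (fun x => ((c * P x : ℝ) : ℂ)) t‖ ≤ ε
    rw [h1, norm_mul, Complex.norm_real, Real.norm_of_nonneg hc0.le]
    refine le_of_sq_le_sq ?_ hε.le
    have h2 : ‖𝓕 (fun x => (P x : ℂ)) t‖ ^ 2 ≤ 2 ^ (m + 1) :=
      le_trans (le_add_of_nonneg_right (sq_nonneg _)) (hF t)
    calc (c * ‖𝓕 (fun x => (P x : ℂ)) t‖) ^ 2 ≤ c ^ 2 * 2 ^ (m + 1) := by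
          rw [mul_pow]
          gcongr
      _ = 2 * A ^ 2 / 2 ^ m := by
          rw [hc]
          field_simp
          ring
      _ ≤ ε ^ 2 := by
          rw [div_lt_iff₀ (by positivity)] at hm
          rw [div_le_iff₀ (by positivity)]
          linarith

theorem exists_isAdmissibleSequence_real :
    ∃ g : ℕ → C_c(ℝ, ℂ), IsAdmissibleSequence g ∧ ∀ n : ℕ, 1 ≤ n → ∀ x, (g n x).im = 0 := by
  choose g h1 h2 h3 h4 using fun n : ℕ =>
    exists_small_fourier_large_integral (δ := 1 / ((n : ℝ) + 1)) (A := ((n : ℝ) ^ 2 + 1) ^ n)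
      (ε := (2 : ℝ)⁻¹ ^ n) (by positivity) (by positivity) (by positivity)
  exact ⟨g, fun n _ => ⟨h1 n, h2 n, h3 n⟩, fun n _ => h4 n⟩

/-! ### Radon measures with continuous density -/

theorem integrable_mul_of_continuous (φ : C_c(ℝ, ℂ)) {h : ℝ → ℂ} (hh : Continuous h) :
    Integrable fun x => φ x * h x :=
  ((map_continuous φ).mul hh).integrable_of_hasCompactSupport φ.hasCompactSupport.mul_right

namespace RadonMeasure

/-- The Radon measure `φ ↦ ∫ φ(x) h(x) dx` with continuous density `h`. -/
noncomputable def ofDensity (h : ℝ → ℂ) (hh : Continuous h) : RadonMeasure where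
  toLinearMap :=
    { toFun := fun φ => ∫ x : ℝ, φ x * h x
      map_add' := by
        intro φ ψ
        rw [← integral_add (integrable_mul_of_continuous φ hh) (integrable_mul_of_continuous ψ hh)]
        simp [add_mul]
      map_smul' := by
        intro c φ
        simp only [CompactlySupportedContinuousMap.coe_smul, Pi.smul_apply, smul_eq_mul,
          RingHom.id_apply, mul_assoc, integral_const_mul] }
  bounded' := by
    intro K hK
    refine ⟨∫ x in K, ‖h x‖, fun φ M hφ hM => ?_⟩
    have hint : IntegrableOn (fun x => ‖h x‖) K := hh.norm.continuousOn.integrableOn_compact hK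
    change ‖∫ x : ℝ, φ x * h x‖ ≤ _
    rw [← setIntegral_eq_integral_of_forall_compl_eq_zero (s := K) fun x hx => by
      simp [image_eq_zero_of_notMem_tsupport fun h' => hx (hφ h')], ← integral_mul_const]
    refine norm_integral_le_of_norm_le (hint.mul_const M) (ae_of_all _ fun x => ?_)
    rw [norm_mul, mul_comm]
    exact mul_le_mul_of_nonneg_left (hM x) (norm_nonneg _)

theorem ofDensity_apply {h : ℝ → ℂ} (hh : Continuous h) (φ : C_c(ℝ, ℂ)) :
    ofDensity h hh φ = ∫ x : ℝ, φ x * h x := rfl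

theorem isSigned_ofDensity {h : ℝ → ℂ} (hh : Continuous h) (him : ∀ x, (h x).im = 0) :
    (ofDensity h hh).IsSigned := by
  intro φ hφ
  have := integral_im (integrable_mul_of_continuous φ hh)
  simp only [RCLike.im_to_complex] at this
  rw [ofDensity_apply, ← this]
  simp [Complex.mul_im, hφ, him]

end RadonMeasure

/-- Two measures on `ℝ` can be compared by testing against continuous functions with compact
support and values in `[0, 1]`. -/
theorem measure_le_of_forall_lintegral_le {m ν : Measure ℝ} [IsLocallyFiniteMeasure m]
    [IsLocallyFiniteMeasure ν]
    (H : ∀ ψ : ℝ → ℝ, Continuous ψ → HasCompactSupport ψ → (∀ x, ψ x ∈ Set.Icc 0 1) →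
      ∫⁻ x, ENNReal.ofReal (ψ x) ∂m ≤ ∫⁻ x, ENNReal.ofReal (ψ x) ∂ν) : m ≤ ν := by
  have hopen (U : Set ℝ) (hU : IsOpen U) : m U ≤ ν U := by
    refine le_of_forall_lt fun r hr => ?_
    obtain ⟨K, hKU, hK, hrK⟩ := hU.exists_lt_isCompact hr
    obtain ⟨ψ, h1, hc, hs, hψ⟩ := exists_continuousMap_one_of_isCompact_subset_isOpen hK hU hKU
    calc r < m K := hrK
      _ = ∫⁻ x, K.indicator 1 x ∂m := (lintegral_indicator_one hK.measurableSet).symm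
      _ ≤ ∫⁻ x, ENNReal.ofReal (ψ x) ∂m := by
        refine lintegral_mono (Set.indicator_le fun x hx => ?_)
        simp [h1 hx]
      _ ≤ ∫⁻ x, ENNReal.ofReal (ψ x) ∂ν := H ψ ψ.continuous hc hψ
      _ ≤ ∫⁻ x, U.indicator 1 x ∂ν := by
        refine lintegral_mono (Set.le_indicator (fun x _ => ?_) fun x hx => ?_)
        · simpa using (hψ x).2
        · simp [image_eq_zero_of_notMem_tsupport fun h => hx (hs h)]
      _ = ν U := lintegral_indicator_one hU.measurableSet
  refine Measure.le_iff'.2 fun A => ?_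
  rw [A.measure_eq_iInf_isOpen ν]
  exact le_iInf₂ fun U hAU => le_iInf fun hU => (measure_mono hAU).trans (hopen U hU)

namespace RadonMeasure

/-- The total variation of a Radon measure with continuous density `h` dominates `|h| dx`. The
functional is tested on `ψ * conj h / (|h| + ε)`, which is continuous, and `ε` tends to `0`. -/
theorem withDensity_le_variation_ofDensity {h : ℝ → ℂ} (hh : Continuous h) :
    volume.withDensity (fun x => ENNReal.ofReal ‖h x‖) ≤ (ofDensity h hh).variation := by
  refine le_sInf fun ν ⟨hν, H⟩ => ?_
  have := IsLocallyFiniteMeasure.withDensity_ofReal (μ := (volume : Measure ℝ)) hh.norm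
  refine measure_le_of_forall_lintegral_le fun ψ hψ hψc hψ01 => ?_
  have hψi : Integrable ψ := hψ.integrable_of_hasCompactSupport hψc
  have hψhi : Integrable fun x => ‖h x‖ * ψ x :=
    (hh.norm.mul hψ).integrable_of_hasCompactSupport hψc.mul_left
  have hm : Measurable fun x => ENNReal.ofReal ‖h x‖ := by fun_prop
  rw [lintegral_withDensity_eq_lintegral_mul _ hm (by fun_prop)]
  simp only [Pi.mul_apply, ← ENNReal.ofReal_mul (norm_nonneg _)]
  rw [← ofReal_integral_eq_lintegral_ofReal hψhi
    (ae_of_all _ fun x => mul_nonneg (norm_nonneg _) (hψ01 x).1)]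
  have key (ε : ℝ) (hε : 0 < ε) : ENNReal.ofReal ((∫ x, ‖h x‖ * ψ x) - ε * ∫ x, ψ x) ≤
      ∫⁻ x, ENNReal.ofReal (ψ x) ∂ν := by
    have hpos (x : ℝ) : 0 < ‖h x‖ + ε := by positivity
    have hne (x : ℝ) : (‖h x‖ : ℂ) + ε ≠ 0 := by exact_mod_cast (hpos x).ne'
    let φ : C_c(ℝ, ℂ) := ⟨⟨fun x => (ψ x : ℂ) * (starRingEnd ℂ (h x) / (‖h x‖ + ε)),
      (Complex.continuous_ofReal.comp hψ).mul ((Complex.continuous_conj.comp hh).div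
        (by fun_prop) hne)⟩, (hψc.comp_left Complex.ofReal_zero).mul_right⟩
    have hφ (x : ℝ) : φ x = (ψ x : ℂ) * (starRingEnd ℂ (h x) / (‖h x‖ + ε)) := rfl
    have hφh (x : ℝ) : φ x * h x = ((ψ x * (‖h x‖ ^ 2 / (‖h x‖ + ε)) : ℝ) : ℂ) := by
      rw [hφ]
      push_cast
      rw [← Complex.conj_mul']
      ring
    have hint : Integrable fun x => ψ x * (‖h x‖ ^ 2 / (‖h x‖ + ε)) :=
      (hψ.mul ((hh.norm.pow 2).div (by fun_prop) fun x => (hpos x).ne')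
        ).integrable_of_hasCompactSupport hψc.mul_right
    have hval : ofDensity h hh φ = ((∫ x, ψ x * (‖h x‖ ^ 2 / (‖h x‖ + ε)) : ℝ) : ℂ) := by
      rw [ofDensity_apply]
      simp_rw [hφh]
      exact integral_ofReal
    calc ENNReal.ofReal ((∫ x, ‖h x‖ * ψ x) - ε * ∫ x, ψ x)
        ≤ ENNReal.ofReal (∫ x, ψ x * (‖h x‖ ^ 2 / (‖h x‖ + ε))) := by
          refine ENNReal.ofReal_le_ofReal ?_
          rw [← integral_const_mul, ← integral_sub hψhi (hψi.const_mul ε)]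
          refine integral_mono (hψhi.sub (hψi.const_mul ε)) hint fun x => ?_
          have : ‖h x‖ - ε ≤ ‖h x‖ ^ 2 / (‖h x‖ + ε) := by
            rw [le_div_iff₀ (hpos x)]
            nlinarith [sq_nonneg ε]
          have := mul_le_mul_of_nonneg_left this (hψ01 x).1
          simp only
          linarith
      _ ≤ ‖ofDensity h hh φ‖ₑ := by
          rw [hval, ← ofReal_norm, Complex.norm_real]
          exact ENNReal.ofReal_le_ofReal (le_abs_self _)
      _ ≤ ∫⁻ x, ‖φ x‖ₑ ∂ν := H φ
      _ ≤ ∫⁻ x, ENNReal.ofReal (ψ x) ∂ν := by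
          refine lintegral_mono fun x => ?_
          rw [← ofReal_norm]
          refine ENNReal.ofReal_le_ofReal ?_
          have : ‖(‖h x‖ : ℂ) + ε‖ = ‖h x‖ + ε := by
            rw [← Complex.ofReal_add, Complex.norm_real, Real.norm_of_nonneg (hpos x).le]
          rw [hφ, norm_mul, norm_div, this, RCLike.norm_conj, Complex.norm_real,
            Real.norm_of_nonneg (hψ01 x).1]
          refine mul_le_of_le_one_right (hψ01 x).1 ((div_le_one (hpos x)).2 ?_)
          linarith
  have hlim : Tendsto (fun ε : ℝ => ENNReal.ofReal ((∫ x, ‖h x‖ * ψ x) - ε * ∫ x, ψ x))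
      (𝓝[>] 0) (𝓝 (ENNReal.ofReal (∫ x, ‖h x‖ * ψ x))) := by
    refine tendsto_nhdsWithin_of_tendsto_nhds ?_
    have : Continuous fun ε : ℝ => ENNReal.ofReal ((∫ x, ‖h x‖ * ψ x) - ε * ∫ x, ψ x) :=
      ENNReal.continuous_ofReal.comp (by fun_prop)
    simpa using this.tendsto 0
  exact le_of_tendsto hlim (eventually_mem_nhdsWithin.mono key)

end RadonMeasure

theorem Polynomial.exists_one_add_norm_eval_le (P : ℂ[X]) : ∃ (C : ℝ) (d : ℕ), 0 < C ∧
    ∀ x : ℝ, 1 + ‖P.eval (x : ℂ)‖ ≤ C * (1 + |x|) ^ d := by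
  refine ⟨1 + ∑ i ∈ Finset.range (P.natDegree + 1), ‖P.coeff i‖, P.natDegree, by positivity,
    fun x => ?_⟩
  have h1 : 1 ≤ 1 + |x| := le_add_of_nonneg_right (abs_nonneg x)
  rw [Polynomial.eval_eq_sum_range, add_mul, one_mul, Finset.sum_mul]
  refine add_le_add (one_le_pow₀ h1) (norm_sum_le_of_le _ fun i hi => ?_)
  rw [norm_mul, norm_pow, Complex.norm_real, Real.norm_eq_abs]
  gcongr
  calc |x| ^ i ≤ (1 + |x|) ^ i := by gcongr; linarith
    _ ≤ _ := pow_le_pow_right₀ h1 (Finset.mem_range_succ_iff.1 hi)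

namespace RadonMeasure

/-- A measure of continuous density `h` is not slowly increasing as soon as the mass of `|h|` on
`[-n - 1/2, -n + 1/2]` is at least `(n² + 1)ⁿ`, which outgrows every polynomial in `n`. -/
theorem not_isSlowlyIncreasing_ofDensity {h : ℝ → ℂ} (hh : Continuous h)
    (hmass : ∀ n : ℕ, 1 ≤ n →
      ((n : ℝ) ^ 2 + 1) ^ n ≤ ∫ x in Set.Icc (-(n : ℝ) - 1 / 2) (-n + 1 / 2), ‖h x‖) :
    ¬ (ofDensity h hh).IsSlowlyIncreasing := by
  rintro ⟨P, hP⟩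
  obtain ⟨C, d, hC, hPC⟩ := P.exists_one_add_norm_eval_le
  have hw : Measurable fun x : ℝ => ENNReal.ofReal (1 / (1 + ‖P.eval (x : ℂ)‖)) := by
    have : Continuous fun x : ℝ => ‖P.eval (x : ℂ)‖ :=
      (P.continuous.comp Complex.continuous_ofReal).norm
    fun_prop
  have hm : Measurable fun x => ENNReal.ofReal ‖h x‖ := by fun_prop
  have key (n : ℕ) (hn : 2 ≤ n) (hd : d < n) : ENNReal.ofReal ((n : ℝ) / C) ≤
      ∫⁻ x : ℝ, ENNReal.ofReal (1 / (1 + ‖P.eval (x : ℂ)‖)) ∂(ofDensity h hh).variation := by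
    have hn' : (2 : ℝ) ≤ n := by exact_mod_cast hn
    set I := Set.Icc (-(n : ℝ) - 1 / 2) (-n + 1 / 2)
    have hhI : IntegrableOn (fun x => ‖h x‖) I :=
      hh.norm.continuousOn.integrableOn_compact isCompact_Icc
    calc ENNReal.ofReal ((n : ℝ) / C)
        ≤ ENNReal.ofReal ((∫ x in I, ‖h x‖) * (1 / (C * (n + 2) ^ d))) := by
          refine ENNReal.ofReal_le_ofReal ?_
          rw [mul_one_div, div_le_div_iff₀ hC (by positivity)]
          have h1 : (n : ℝ) * (n + 2) ^ d ≤ ∫ x in I, ‖h x‖ :=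
            calc (n : ℝ) * (n + 2) ^ d ≤ (n + 2) * (n + 2) ^ d := by gcongr; linarith
              _ = (n + 2) ^ (d + 1) := by ring
              _ ≤ ((n : ℝ) + 2) ^ n := pow_le_pow_right₀ (by linarith) hd
              _ ≤ ((n : ℝ) ^ 2 + 1) ^ n := by gcongr ?_ ^ n; nlinarith
              _ ≤ _ := hmass n (by lia)
          calc (n : ℝ) * (C * (n + 2) ^ d) = (n * (n + 2) ^ d) * C := by ring
            _ ≤ _ := by gcongr
      _ = ∫⁻ x in I, ENNReal.ofReal (‖h x‖ * (1 / (C * (n + 2) ^ d))) := by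
          rw [← integral_mul_const]
          exact ofReal_integral_eq_lintegral_ofReal (hhI.mul_const _)
            (ae_of_all _ fun x => by positivity)
      _ ≤ ∫⁻ x in I, ENNReal.ofReal ‖h x‖ * ENNReal.ofReal (1 / (1 + ‖P.eval (x : ℂ)‖)) := by
          refine setLIntegral_mono' measurableSet_Icc fun x hx => ?_
          rw [ENNReal.ofReal_mul (norm_nonneg _)]
          gcongr
          refine (hPC x).trans ?_
          have : |x| ≤ n + 1 := abs_le.2 ⟨by linarith [hx.1], by linarith [hx.2]⟩
          gcongr ?_ * ?_ ^ d
          linarith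
      _ ≤ ∫⁻ x, ENNReal.ofReal ‖h x‖ * ENNReal.ofReal (1 / (1 + ‖P.eval (x : ℂ)‖)) :=
          setLIntegral_le_lintegral _ _
      _ = ∫⁻ x, ENNReal.ofReal (1 / (1 + ‖P.eval (x : ℂ)‖))
            ∂volume.withDensity (fun x => ENNReal.ofReal ‖h x‖) :=
          (lintegral_withDensity_eq_lintegral_mul _ hm hw).symm
      _ ≤ _ := lintegral_mono' (withDensity_le_variation_ofDensity hh) le_rfl
  have hlim : Tendsto (fun n : ℕ => ENNReal.ofReal ((n : ℝ) / C)) atTop (𝓝 ⊤) :=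
    ENNReal.tendsto_ofReal_atTop.comp (tendsto_natCast_atTop_atTop.atTop_div_const hC)
  refine hP.not_ge (le_of_tendsto hlim ?_)
  filter_upwards [eventually_ge_atTop 2, eventually_gt_atTop d] with n h2 hd using key n h2 hd

end RadonMeasure

/-! ### The limit density -/

/-- The density `∑_{j=1}^n g_j(x + j)` of the measure `partialMeasure g n`. -/
noncomputable def partialDensity (g : ℕ → C_c(ℝ, ℂ)) (n : ℕ) (x : ℝ) : ℂ :=
  ∑ j ∈ Finset.Icc 1 n, g j (x + (j : ℝ))

/-- The density `∑_{j ≥ 1} g_j(x + j)`. The term of index `j` lives near `-j`, so the sum is cut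
at an index exceeding `|x|`. -/
noncomputable def limitDensity (g : ℕ → C_c(ℝ, ℂ)) (x : ℝ) : ℂ :=
  partialDensity g (⌈|x|⌉₊ + 1) x

theorem continuous_partialDensity (g : ℕ → C_c(ℝ, ℂ)) (n : ℕ) : Continuous (partialDensity g n) :=
  continuous_finsetSum _ fun j _ =>
    (map_continuous (g j)).comp (continuous_id.add continuous_const)

theorem partialMeasure_apply (g : ℕ → C_c(ℝ, ℂ)) (n : ℕ) (φ : C_c(ℝ, ℂ)) :
    partialMeasure g n φ = ∑ j ∈ Finset.Icc 1 n, ∫ x : ℝ, φ x * g j (x + (j : ℝ)) := rfl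

theorem partialMeasure_apply_eq_integral (g : ℕ → C_c(ℝ, ℂ)) (n : ℕ) (φ : C_c(ℝ, ℂ)) :
    partialMeasure g n φ = ∫ x : ℝ, φ x * partialDensity g n x := by
  simp only [partialMeasure_apply, partialDensity, Finset.mul_sum]
  exact (integral_finsetSum _ fun j _ => integrable_mul_translate φ (g j) j).symm

namespace IsAdmissibleSequence

variable {g : ℕ → C_c(ℝ, ℂ)}

theorem abs_add_le (hg : IsAdmissibleSequence g) {j : ℕ} (hj : 1 ≤ j) {x : ℝ}
    (hx : g j (x + j) ≠ 0) : |x + j| ≤ 1 / ((j : ℝ) + 1) :=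
  abs_le.2 ((hg j hj).1 (subset_tsupport _ hx))

theorem abs_add_le_half (hg : IsAdmissibleSequence g) {j : ℕ} (hj : 1 ≤ j) {x : ℝ}
    (hx : g j (x + j) ≠ 0) : |x + j| ≤ 1 / 2 := by
  refine (hg.abs_add_le hj hx).trans ?_
  have : (1 : ℝ) ≤ j := by exact_mod_cast hj
  gcongr
  linarith

theorem partialDensity_eq_of_le (hg : IsAdmissibleSequence g) {n m : ℕ} {x : ℝ} (hx : |x| ≤ n)
    (hnm : n ≤ m) : partialDensity g m x = partialDensity g n x := by
  refine (Finset.sum_subset (Finset.Icc_subset_Icc_right hnm) fun j hj hj' => ?_).symm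
  by_contra hne
  have h1 := Finset.mem_Icc.1 hj
  have h2 : (n : ℝ) + 1 ≤ j := by
    exact_mod_cast not_le.1 fun h => hj' (Finset.mem_Icc.2 ⟨h1.1, h⟩)
  have h3 := (abs_le.1 (hg.abs_add_le_half h1.1 hne)).2
  have h4 := (abs_le.1 hx).1
  linarith

theorem limitDensity_eq (hg : IsAdmissibleSequence g) {n : ℕ} {x : ℝ} (hx : |x| ≤ n) :
    limitDensity g x = partialDensity g n x := by
  have h1 : |x| ≤ (⌈|x|⌉₊ + 1 : ℕ) := (Nat.le_ceil _).trans (by simp)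
  rcases le_total n (⌈|x|⌉₊ + 1) with h | h
  · exact hg.partialDensity_eq_of_le hx h
  · exact (hg.partialDensity_eq_of_le h1 h).symm

theorem continuous_limitDensity (hg : IsAdmissibleSequence g) : Continuous (limitDensity g) := by
  refine continuous_iff_continuousAt.2 fun x => ?_
  obtain ⟨n, hn⟩ := exists_nat_gt |x|
  refine (continuous_partialDensity g n).continuousAt.congr ?_
  filter_upwards [(continuous_abs.isOpen_preimage _ isOpen_Iio).mem_nhds hn] with y hy
  exact (hg.limitDensity_eq (le_of_lt hy)).symm

theorem vagueTendsto (hg : IsAdmissibleSequence g) : RadonMeasure.VagueTendsto (partialMeasure g)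
    (RadonMeasure.ofDensity (limitDensity g) hg.continuous_limitDensity) := by
  intro φ
  obtain ⟨r, hr⟩ := (φ.hasCompactSupport.isCompact.isBounded).subset_closedBall 0
  refine tendsto_const_nhds.congr' ?_
  filter_upwards [eventually_ge_atTop ⌈r⌉₊] with n hn
  refine Eq.trans (integral_congr_ae (ae_of_all _ fun x => ?_))
    (partialMeasure_apply_eq_integral g n φ).symm
  by_cases hx : φ x = 0
  · simp [hx]
  · have : |x| ≤ r := by simpa using hr (subset_tsupport _ hx)
    simp only [hg.limitDensity_eq (this.trans (Nat.ceil_le.1 hn))]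

/-- The translates `g_j(· + j)` have disjoint supports, so no mass is lost in their sum. -/
theorem norm_le_norm_limitDensity (hg : IsAdmissibleSequence g) {n : ℕ} (hn : 1 ≤ n) (x : ℝ) :
    ‖g n (x + n)‖ ≤ ‖limitDensity g x‖ := by
  by_cases hx : g n (x + n) = 0
  · simp [hx]
  have h1 := abs_le.1 (hg.abs_add_le_half hn hx)
  have h2 : |x| ≤ (n + 1 : ℕ) := by
    push_cast
    exact abs_le.2 ⟨by linarith, by linarith [(Nat.cast_nonneg n : (0 : ℝ) ≤ n)]⟩
  rw [hg.limitDensity_eq h2, partialDensity, Finset.sum_eq_single_of_mem n (by simp [hn])]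
  intro j hj hjn
  by_contra hne
  have hj1 := (Finset.mem_Icc.1 hj).1
  have h3 := abs_le.1 (hg.abs_add_le hj1 hne)
  have h4 := abs_le.1 (hg.abs_add_le hn hx)
  -- Two distinct indices have radii of sum at most `1/2 + 1/3`, less than the distance of centres.
  have hrad (a b : ℕ) (ha : 1 ≤ a) (hab : a < b) :
      1 / ((a : ℝ) + 1) + 1 / ((b : ℝ) + 1) < b - a := by
    have ha' : (1 : ℝ) ≤ a := by exact_mod_cast ha
    have hab' : (a : ℝ) + 1 ≤ b := by exact_mod_cast hab
    have e1 : 1 / ((a : ℝ) + 1) ≤ 1 / 2 := by gcongr; linarith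
    have e2 : 1 / ((b : ℝ) + 1) ≤ 1 / 3 := by gcongr; linarith
    linarith
  rcases lt_or_gt_of_ne hjn with h | h
  · linarith [hrad j n hj1 h]
  · linarith [hrad n j hn h]

theorem le_setIntegral_norm_limitDensity (hg : IsAdmissibleSequence g) {n : ℕ} (hn : 1 ≤ n) :
    ((n : ℝ) ^ 2 + 1) ^ n ≤
      ∫ x in Set.Icc (-(n : ℝ) - 1 / 2) (-n + 1 / 2), ‖limitDensity g x‖ := by
  refine (hg n hn).2.1.trans ?_
  rw [← integral_add_right_eq_self (fun x => ‖g n x‖) (n : ℝ),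
    ← setIntegral_eq_integral_of_forall_compl_eq_zero
      (s := Set.Icc (-(n : ℝ) - 1 / 2) (-n + 1 / 2))]
  · exact setIntegral_mono (integrable_norm_translate (g n) n).integrableOn
      (hg.continuous_limitDensity.norm.continuousOn.integrableOn_compact isCompact_Icc)
      fun x => hg.norm_le_norm_limitDensity hn x
  · intro x hx
    by_contra hne
    have h := abs_le.1 (hg.abs_add_le_half hn (norm_ne_zero_iff.1 hne))
    exact hx ⟨by linarith, by linarith⟩

/-! ### Temperedness -/

theorem norm_fourier_translate_le (hg : IsAdmissibleSequence g) {n : ℕ} (hn : 1 ≤ n) (t : ℝ) :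
    ‖𝓕 (fun x : ℝ => g n (x + n)) t‖ ≤ (2 : ℝ)⁻¹ ^ n := by
  rw [fourier_comp_add_right (fun x => g n x), Circle.norm_smul]
  exact (hg n hn).2.2 t

/-- The partial measures converge on Schwartz functions to the inverse Fourier transform of the
bounded continuous function `∑ⱼ (g_j(· + j))^`. -/
theorem exists_tendsto_temperedDistribution (hg : IsAdmissibleSequence g) :
    ∃ T : 𝓢'(ℝ, ℂ), ∀ f : 𝓢(ℝ, ℂ),
      Tendsto (fun n => ∑ j ∈ Finset.Icc 1 n, ∫ x : ℝ, f x * g j (x + (j : ℝ))) atTop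
        (𝓝 (T f)) := by
  set τ : ℕ → ℝ → ℂ := fun j x => g (j + 1) (x + (j + 1 : ℕ))
  have hτi (j : ℕ) : Integrable (τ j) :=
    ((map_continuous (g (j + 1))).integrable_of_hasCompactSupport
      (g (j + 1)).hasCompactSupport).comp_add_right _
  have hτc (j : ℕ) : Continuous (𝓕 (τ j)) :=
    VectorFourier.fourierIntegral_continuous Real.continuous_fourierChar continuous_inner (hτi j)
  have hτb (j : ℕ) (t : ℝ) : ‖𝓕 (τ j) t‖ ≤ (2 : ℝ)⁻¹ ^ (j + 1) :=
    hg.norm_fourier_translate_le j.succ_pos t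
  have hsum : Summable fun j : ℕ => (2 : ℝ)⁻¹ ^ (j + 1) :=
    (summable_nat_add_iff 1).2 (summable_geometric_of_lt_one (by norm_num) (by norm_num))
  let G : ℝ → ℂ := fun t => ∑' j, 𝓕 (τ j) t
  have hGc : Continuous G := continuous_tsum hτc hsum hτb
  have hGm : MemLp G ⊤ volume :=
    memLp_top_of_bound hGc.aestronglyMeasurable (∑' j : ℕ, (2 : ℝ)⁻¹ ^ (j + 1))
      (ae_of_all _ fun t => tsum_of_norm_bounded hsum.hasSum fun j => hτb j t)
  refine ⟨𝓕⁻ (Lp.toTemperedDistribution hGm.toLp), fun f => ?_⟩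
  have hT : 𝓕⁻ (Lp.toTemperedDistribution hGm.toLp) f = ∫ t, 𝓕⁻ f t * G t := by
    rw [TemperedDistribution.fourierInv_apply, Lp.toTemperedDistribution_apply]
    refine integral_congr_ae ?_
    filter_upwards [hGm.coeFn_toLp] with t ht
    rw [ht, smul_eq_mul]
  have hfi : Integrable (𝓕⁻ f : 𝓢(ℝ, ℂ)) := (𝓕⁻ f).integrable
  have hterm (j : ℕ) : ∫ t, 𝓕⁻ f t * 𝓕 (τ j) t = ∫ x, f x * τ j x := by
    have h := VectorFourier.integral_fourierIntegral_smul_eq_flip (L := innerₗ ℝ)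
      Real.continuous_fourierChar continuous_inner (hτi j) hfi
    rw [flip_innerₗ] at h
    have h2 (x : ℝ) : VectorFourier.fourierIntegral Real.fourierChar volume (innerₗ ℝ)
        (𝓕⁻ f : 𝓢(ℝ, ℂ)) x = f x := by
      change 𝓕 ((𝓕⁻ f : 𝓢(ℝ, ℂ)) : ℝ → ℂ) x = f x
      rw [← SchwartzMap.fourier_coe, FourierTransform.fourier_fourierInv_eq]
    simp only [smul_eq_mul, h2] at h
    simp only [mul_comm (f _)]
    rw [← h]
    congr 1
    ext t
    exact mul_comm _ _
  have hint (j : ℕ) : Integrable fun t => 𝓕⁻ f t * 𝓕 (τ j) t :=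
    hfi.mul_bdd (hτc j).aestronglyMeasurable (ae_of_all _ (hτb j))
  have hHS : HasSum (fun j => ∫ t, 𝓕⁻ f t * 𝓕 (τ j) t) (∫ t, 𝓕⁻ f t * G t) := by
    simp only [G, ← tsum_mul_left]
    refine hasSum_integral_of_summable_integral_norm hint ?_
    refine Summable.of_nonneg_of_le (fun j => integral_nonneg fun t => norm_nonneg _)
      (fun j => ?_) (hsum.mul_left (∫ t, ‖𝓕⁻ f t‖))
    rw [← integral_mul_const]
    refine integral_mono (hint j).norm (hfi.norm.mul_const _) fun t => ?_
    simp only [norm_mul]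
    exact mul_le_mul_of_nonneg_left (hτb j t) (norm_nonneg _)
  rw [hT]
  refine hHS.tendsto_sum_nat.congr fun n => ?_
  rw [Finset.sum_congr rfl fun j _ => hterm j, Finset.range_eq_Ico, Finset.sum_Ico_add' (fun j => ∫ x, f x * g j (x + (j : ℝ)))]
  rfl

theorem isTempered (hg : IsAdmissibleSequence g) :
    (RadonMeasure.ofDensity (limitDensity g) hg.continuous_limitDensity).IsTempered := by
  obtain ⟨T, hT⟩ := hg.exists_tendsto_temperedDistribution
  exact ⟨T, fun φ hφ => tendsto_nhds_unique (hg.vagueTendsto φ) (hT _)⟩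

end IsAdmissibleSequence

theorem mainTheorem4 :
    (∃ g : ℕ → C_c(ℝ, ℂ), IsAdmissibleSequence g ∧ ∀ n : ℕ, 1 ≤ n → ∀ x, (g n x).im = 0) ∧
    ∀ g : ℕ → C_c(ℝ, ℂ), IsAdmissibleSequence g →
      ∃ μ : RadonMeasure,
        RadonMeasure.VagueTendsto (partialMeasure g) μ ∧
        ((∀ n : ℕ, 1 ≤ n → ∀ x, (g n x).im = 0) → μ.IsSigned) ∧
        μ.IsTempered ∧
        ¬ μ.IsSlowlyIncreasing := by
  refine ⟨exists_isAdmissibleSequence_real, fun g hg =>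
    ⟨RadonMeasure.ofDensity (limitDensity g) hg.continuous_limitDensity, hg.vagueTendsto,
      fun him => ?_, hg.isTempered, ?_⟩⟩
  · refine RadonMeasure.isSigned_ofDensity _ fun x => ?_
    rw [limitDensity, partialDensity, Complex.im_sum]
    exact Finset.sum_eq_zero fun j hj => him j (Finset.mem_Icc.1 hj).1 _
  · exact RadonMeasure.not_isSlowlyIncreasing_ofDensity _ fun n hn =>
      hg.le_setIntegral_norm_limitDensity hn
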